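/- **Setting.** For each integer $k\ge 1$ let $n_k,m_k\ge 2$ be integers with $\sup_k\max\{n_k,m_k\}<\infty$, and let $\mathcal D_k\subseteq\{0,\dots,n_k-1\}\times\{0,\dots,m_k-1\}$ with $r_k=\operatorname{card}\mathcal D_k\ge 2$. For $w\in\mathcal D_k$ put $\Phi_w(x)=\operatorname{diag}(n_k^{-1},m_k^{-1})(x+w)$ on $\mathbb R^2$, and let $$E=\bigcap_{k\ge1}\ \bigcup_{w_1\in\mathcal D_1,\dots,w_k\in\mathcal D_k}\Phi_{w_1}\circ\cdots\circ\Phi_{w_k}\big([0,1]^2\big)$$ be the associated self-affine Moran set. Let $\Sigma^\infty=\prod_{k\ge1}\mathcal D_k$ and $$\Pi:\Sigma^\infty\to\mathbb R^2,\qquad \Pi(w_1w_2\cdots)=\sum_{k\ge1}\operatorname{diag}\Big(\prod_{h\le k}n_h^{-1},\prod_{h\le k}m_h^{-1}\Big)w_k .$$ Let $\mathcal P$ be the set of all sequences $\mathbf p=(\mathbf p_k)_{k\ge1}$ with $\mathbf p_k=(p_k(w))_{w\in\mathcal D_k}$ a probability vector on $\mathcal D_k$. For $\mathbf p\in\mathcal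 P$ let $\nu_{\mathbf p}$ be the product measure on $\Sigma^\infty$ with marginals $\mathbf p_k$, and let $\mu_{\mathbf p}(A)=\nu_{\mathbf p}(\Pi^{-1}A)$ be the self-affine Moran measure. For a finite Borel measure $\mu$ on $\mathbb R^2$ put $\dim_H\mu=\inf\{\dim_H A:\mu(A^c)=0\}$ and $\dim_P\mu=\inf\{\dim_P A:\mu(A^c)=0\}$, where $\dim_H$ and $\dim_P$ of a set are Hausdorff and packing dimension. Call $\mathcal D_k$ left, right, bottom or top empty if, respectively, $i\ne0$, $i\ne n_k-1$, $j\ne0$ or $j\ne m_k-1$ for all $(i,j)\in\mathcal D_k$. The set $E$ satisfies the boundary separation condition (BSC) if for each of these four properties the limit $$\lim_{N\to\infty}\frac1N\operatorname{card}\{1\le k\le N:\mathcal D_k\text{ has the property}\}$$ exists (positivity of the limits is not required). **Statement.** Suppose that $E$ satisfies BSC, that $n_k\ge m_k$ for all $k\ge1$, and that for every $k$ there is a number $c_k$ such that, for each $j$, the number $r_k(j)=\operatorname{card}\{i:(i,j)\in\mathcal D_k\}$ is either $0$ or $c_k$. Then there exists $\mathbf p\in\mathcal P$, namely the uniform one $p_k(w)=1/r_k$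 for $w\in\mathcal D_k$, such that $$\dim_H\mu_{\mathbf p}=\max\{\dim_H\mu_{\mathbf p'}:\mathbf p'\in\mathcal P\}=\dim_H E,$$ $$\dim_P\mu_{\mathbf p}=\max\{\dim_P\mu_{\mathbf p'}:\mathbf p'\in\mathcal P\}=\dim_P E .$$ -/

import Mathlib

open MeasureTheory Filter Topology
open scoped NNReal ENNReal

/-! ### Packing measures, packing dimension, dimensions of measures -/

/-- `P` encodes a family of pairwise disjoint closed balls `closedBall b.1 b.2`, centred in `F` and
with radii in `(0, δ]`. -/
def IsBallPacking {X : Type*} [PseudoMetricSpace X] (δ : ℝ) (F : Set X) (P : Set (X × ℝ)) : Prop :=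
  (∀ b ∈ P, b.1 ∈ F ∧ 0 < b.2 ∧ b.2 ≤ δ) ∧
    P.PairwiseDisjoint fun b => Metric.closedBall b.1 b.2

/-- `P^s_δ(F)`: the supremum of `∑ (2 r_i)^s` over all packings of `F` by disjoint balls of radii
`r_i ≤ δ` with centres in `F`. -/
noncomputable def packingSum {X : Type*} [PseudoMetricSpace X] (s : ℝ≥0) (δ : ℝ) (F : Set X) :
    ℝ≥0∞ :=
  ⨆ (P : Set (X × ℝ)) (_ : IsBallPacking δ F P), ∑' b : P, ENNReal.ofReal (2 * b.1.2) ^ (s : ℝ)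

/-- The packing premeasure `P^s_0(F) = lim_{δ → 0} P^s_δ(F)`; the limit is an infimum, because
`P^s_δ(F)` is nondecreasing in `δ`. -/
noncomputable def packingPremeasure {X : Type*} [PseudoMetricSpace X] (s : ℝ≥0) (F : Set X) :
    ℝ≥0∞ :=
  ⨅ (δ : ℝ) (_ : 0 < δ), packingSum s δ F

/-- The `s`-dimensional packing measure: the infimum of `∑ P^s_0(F_i)` over countable covers. -/
noncomputable def packingMeasure {X : Type*} [PseudoMetricSpace X] (s : ℝ≥0) (F : Set X) : ℝ≥0∞ :=
  ⨅ (G : ℕ → Set X) (_ : F ⊆ ⋃ i, G i), ∑' i, packingPremeasure s (G i)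

/-- The packing dimension `sup {s ≥ 0 : P^s(F) = ∞}` of a set. -/
noncomputable def dimP {X : Type*} [PseudoMetricSpace X] (F : Set X) : ℝ≥0∞ :=
  ⨆ (s : ℝ≥0) (_ : packingMeasure s F = ∞), (s : ℝ≥0∞)

/-- The Hausdorff dimension `inf {dim_H A : μ(Aᶜ) = 0}` of a measure. -/
noncomputable def dimHMeasure {X : Type*} [EMetricSpace X] [MeasurableSpace X] (μ : Measure X) :
    ℝ≥0∞ :=
  ⨅ (A : Set X) (_ : μ Aᶜ = 0), dimH A

/-- The packing dimension `inf {dim_P A : μ(Aᶜ) = 0}` of a measure. -/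
noncomputable def dimPMeasure {X : Type*} [PseudoMetricSpace X] [MeasurableSpace X]
    (μ : Measure X) : ℝ≥0∞ :=
  ⨅ (A : Set X) (_ : μ Aᶜ = 0), dimP A

/-! ### Self-affine Moran sets -/

/-- The data of a self-affine Moran construction. The levels are indexed from `0`, so that
`n k`, `m k`, `D k` are the usual `n_{k+1}`, `m_{k+1}`, `𝒟_{k+1}`. -/
structure MoranConstruction where
  n : ℕ → ℕ
  m : ℕ → ℕ
  D : ℕ → Finset (ℕ × ℕ)
  two_le_n : ∀ k, 2 ≤ n k
  two_le_m : ∀ k, 2 ≤ m k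
  D_subset : ∀ k, D k ⊆ Finset.range (n k) ×ˢ Finset.range (m k)
  two_le_card : ∀ k, 2 ≤ (D k).card

namespace MoranConstruction

/-- The sequence space `Σ^∞ = ∏ 𝒟_k`. It carries the product σ-algebra, which is the Borel
σ-algebra of the product topology. -/
abbrev Seq (S : MoranConstruction) : Type := (k : ℕ) → {w : ℕ × ℕ // w ∈ S.D k}

/-- The words `Σ^k` of length `k`. -/
abbrev Word (S : MoranConstruction) (k : ℕ) : Type := (j : Fin k) → {w : ℕ × ℕ // w ∈ S.D j}

/-- The affine map `Φ_w(x) = T_k (x + w)` with `T_k = diag(1 / n_k, 1 / m_k)`. -/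
noncomputable def digitMap (S : MoranConstruction) (k : ℕ) (w : ℕ × ℕ)
    (x : EuclideanSpace ℝ (Fin 2)) : EuclideanSpace ℝ (Fin 2) :=
  !₂[(x 0 + w.1) / S.n k, (x 1 + w.2) / S.m k]

/-- `Φ_𝐰 = Φ_{w_1} ∘ ⋯ ∘ Φ_{w_k}`. -/
noncomputable def wordMap (S : MoranConstruction) :
    (k : ℕ) → S.Word k → EuclideanSpace ℝ (Fin 2) → EuclideanSpace ℝ (Fin 2)
  | 0, _ => id
  | k + 1, w => wordMap S k (fun j => w j.castSucc) ∘ S.digitMap k (w (Fin.last k))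

/-- The unit square `J = [0,1]²`. -/
def unitSquare : Set (EuclideanSpace ℝ (Fin 2)) := {x | ∀ i, x i ∈ Set.Icc (0 : ℝ) 1}

/-- The self-affine Moran set `E = ⋂_{k ≥ 1} ⋃_{𝐰 ∈ Σ^k} Φ_𝐰(J)`. -/
def moranSet (S : MoranConstruction) : Set (EuclideanSpace ℝ (Fin 2)) :=
  ⋂ (k : ℕ) (_ : 1 ≤ k), ⋃ w : S.Word k, S.wordMap k w '' unitSquare

/-- The projection `Π(𝐰) = ∑_k diag(∏_{h ≤ k} 1 / n_h, ∏_{h ≤ k} 1 / m_h) w_k`. -/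
noncomputable def proj (S : MoranConstruction) (w : S.Seq) : EuclideanSpace ℝ (Fin 2) :=
  !₂[∑' k, (∏ h ∈ Finset.range (k + 1), (S.n h : ℝ)⁻¹) * ((w k).1.1 : ℝ),
    ∑' k, (∏ h ∈ Finset.range (k + 1), (S.m h : ℝ)⁻¹) * ((w k).1.2 : ℝ)]

/-- The set `𝒫 = ∏ 𝒫_k` of sequences of probability vectors, `p k` being one on `𝒟_k`. -/
abbrev Weights (S : MoranConstruction) : Type := (k : ℕ) → PMF {w : ℕ × ℕ // w ∈ S.D k}

/-- The product measure `ν_𝐩` on `Σ^∞`, with `ν_𝐩([w_1 ⋯ w_k]) = p_1(w_1) ⋯ p_k(w_k)`. -/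
noncomputable def symbolicMeasure (S : MoranConstruction) (p : S.Weights) : Measure S.Seq :=
  Measure.infinitePi fun k => (p k).toMeasure

/-- The self-affine Moran measure `μ_𝐩(A) = ν_𝐩(Π⁻¹ A)`. -/
noncomputable def moranMeasure (S : MoranConstruction) (p : S.Weights) :
    Measure (EuclideanSpace ℝ (Fin 2)) :=
  (S.symbolicMeasure p).map S.proj

/-- A digit series in varying bases converges. -/
lemma summable_digits {b d : ℕ → ℕ} (hb : ∀ k, 2 ≤ b k) (hd : ∀ k, d k < b k) :
    Summable fun k => (∏ h ∈ Finset.range (k + 1), (b h : ℝ)⁻¹) * (d k : ℝ) := by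
  refine Summable.of_nonneg_of_le (fun k => by positivity) (fun k => ?_)
    (summable_geometric_of_lt_one (r := (2 : ℝ)⁻¹) (by norm_num) (by norm_num))
  have hbk : (2 : ℝ) ≤ b k := by exact_mod_cast hb k
  have hdk : (d k : ℝ) ≤ b k := by exact_mod_cast (hd k).le
  have h1 : ∏ h ∈ Finset.range k, (b h : ℝ)⁻¹ ≤ (2 : ℝ)⁻¹ ^ k := by
    calc ∏ h ∈ Finset.range k, (b h : ℝ)⁻¹ ≤ ∏ _h ∈ Finset.range k, (2 : ℝ)⁻¹ := by
          refine Finset.prod_le_prod (fun _ _ => by positivity) fun i _ => ?_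
          have : (2 : ℝ) ≤ b i := by exact_mod_cast hb i
          gcongr
      _ = _ := by simp
  have h2 : (b k : ℝ)⁻¹ * d k ≤ 1 := by
    rw [inv_mul_le_one₀ (by linarith)]; exact hdk
  rw [Finset.prod_range_succ, mul_assoc]
  calc _ ≤ (∏ h ∈ Finset.range k, (b h : ℝ)⁻¹) * 1 := by gcongr
    _ ≤ _ := by simpa using h1

/-- The projection is measurable, so `moranMeasure` is a genuine image measure. -/
lemma measurable_proj (S : MoranConstruction) : Measurable S.proj := by
  have hw (w : S.Seq) (k : ℕ) : (w k).1.1 < S.n k ∧ (w k).1.2 < S.m k := by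
    simpa using S.D_subset k (w k).2
  have key (f : ℕ → S.Seq → ℝ) (hf : ∀ k, Measurable (f k)) (hs : ∀ w, Summable fun k => f k w) :
      Measurable fun w => ∑' k, f k w :=
    measurable_of_tendsto_metrizable (f := fun N w => ∑ k ∈ Finset.range N, f k w)
      (fun N => Finset.measurable_sum _ fun k _ => hf k)
      (tendsto_pi_nhds.2 fun w => (hs w).hasSum.tendsto_sum_nat)
  have hm (k : ℕ) (g : {w : ℕ × ℕ // w ∈ S.D k} → ℝ) : Measurable fun w : S.Seq => g (w k) :=
    (measurable_of_countable g).comp (measurable_pi_apply k)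
  refine (PiLp.continuous_toLp 2 _).measurable.comp (measurable_pi_iff.2 fun i => ?_)
  fin_cases i
  · exact key _ (fun k => (hm k fun w => (w.1.1 : ℝ)).const_mul _)
      fun w => summable_digits S.two_le_n fun k => (hw w k).1
  · exact key _ (fun k => (hm k fun w => (w.1.2 : ℝ)).const_mul _)
      fun w => summable_digits S.two_le_m fun k => (hw w k).2

instance (S : MoranConstruction) (p : S.Weights) : IsProbabilityMeasure (S.moranMeasure p) :=
  haveI : IsProbabilityMeasure (S.symbolicMeasure p) := by
    unfold symbolicMeasure; infer_instance
  Measure.isProbabilityMeasure_map S.measurable_proj.aemeasurable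

/-- The set of levels `A` has a frequency: `card {k among the first N levels : k ∈ A} / N`
converges as `N → ∞`. -/
def HasFrequency (A : Set ℕ) : Prop :=
  ∃ c : ℝ, Tendsto (fun N : ℕ => ({k | k < N ∧ k ∈ A}.ncard : ℝ) / N) atTop (𝓝 c)

/-- The boundary separation condition: the levels whose digit set is left empty, right empty,
bottom empty and top empty, respectively, have frequencies `c_L, c_R, c_B, c_T`. Positivity of these
limits is not demanded. -/
structure BSC (S : MoranConstruction) : Prop where
  left : HasFrequency {k | ∀ w ∈ S.D k, w.1 ≠ 0}
  right : HasFrequency {k | ∀ w ∈ S.D k, w.1 ≠ S.n k - 1}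
  bottom : HasFrequency {k | ∀ w ∈ S.D k, w.2 ≠ 0}
  top : HasFrequency {k | ∀ w ∈ S.D k, w.2 ≠ S.m k - 1}

/-- `r_k(j) = card {i : (i, j) ∈ 𝒟_k}`. -/
def rowCard (S : MoranConstruction) (k j : ℕ) : ℕ :=
  {w ∈ S.D k | w.2 = j}.card

end MoranConstruction

/-! Write M_k and N_l for the products of the first k numbers m and the first l numbers n. An
approximate square of level k fixes both digits up to l = `columnLevel k`, where N_l is comparable
to M_k, and only the second digits from l to k. Under the uniform weights it has mass ∏_{h<l} 1/r_h
· ∏_{l≤h<k} c_h/r_h. Since all nonempty rows of a level have the same size, this number q_k is the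
same for every approximate square of level k (`symbolicMeasure_approxSquare`).

A ball of radius 1/M_k meets at most 16 approximate squares (`moranMeasure_closedBall_le`), and a
ball of radius (K+1)/M_k centred in E contains the image of one (`le_moranMeasure_closedBall`). Up
to constants, balls centred in E thus have mass q_k, whatever the centre.

For such a homogeneous measure, comparing q_k with M_k^{-s} decides everything: q_k ≤ M_k^{-s}
eventually (infinitely often) bounds the Hausdorff (packing) dimension of the measure below by s,
and the negation bounds that of E above by s (`dimH_le_dimHMeasure_of_homogeneous`,
`dimP_le_dimPMeasure_of_homogeneous`). Every μ_p is carried by E, so no other weights do better. -/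

/-- A radius below `ρ N` lies between two consecutive terms of a null sequence `ρ`. -/
lemma exists_scale {ρ : ℕ → ℝ} (hρ0 : Tendsto ρ atTop (𝓝 0)) {N : ℕ} {r : ℝ} (hr : 0 < r)
    (hrN : r ≤ ρ N) : ∃ k, N ≤ k ∧ ρ (k + 1) < r ∧ r ≤ ρ k := by
  classical
  have hex : ∃ j, ρ (N + j) < r := by
    have h1 : ∀ᶠ k in atTop, ρ k < r := hρ0.eventually (gt_mem_nhds hr)
    obtain ⟨k, hk, hk'⟩ := (h1.and (eventually_ge_atTop N)).exists
    exact ⟨k - N, by rwa [Nat.add_sub_cancel' hk']⟩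
  have hne : Nat.find hex ≠ 0 := fun h => by
    have := Nat.find_spec hex
    rw [h, add_zero] at this
    linarith
  obtain ⟨j, hj⟩ := Nat.exists_eq_succ_of_ne_zero hne
  refine ⟨N + j, by omega, ?_, ?_⟩
  · have := Nat.find_spec hex
    rwa [hj, Nat.succ_eq_add_one, ← add_assoc] at this
  · exact not_lt.1 (Nat.find_min hex (m := j) (by omega))

/-! ### Disjoint balls: countability, total mass, Vitali covering. -/

section Balls

variable {X : Type*} [PseudoMetricSpace X] [SecondCountableTopology X]

lemma countable_of_pairwiseDisjoint_closedBall {ι : Type*} {P : Set ι} {x : ι → X} {r : ι → ℝ}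
    (hr : ∀ i ∈ P, 0 < r i) (h : P.PairwiseDisjoint fun i => Metric.closedBall (x i) (r i)) :
    P.Countable :=
  h.countable_of_nonempty_interior fun i hi =>
    ⟨x i, Metric.ball_subset_interior_closedBall (Metric.mem_ball_self (hr i hi))⟩

omit [SecondCountableTopology X] in
lemma tsum_measure_closedBall_le_one [MeasurableSpace X] [BorelSpace X] (μ : Measure X)
    [IsProbabilityMeasure μ] {ι : Type*} {P : Set ι} {x : ι → X} {r : ι → ℝ}
    (h : P.PairwiseDisjoint fun i => Metric.closedBall (x i) (r i)) :
    ∑' i : P, μ (Metric.closedBall (x i) (r i)) ≤ 1 :=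
  (tsum_meas_le_meas_iUnion_of_disjoint μ
    (As := fun i : P => Metric.closedBall (x i) (r i))
    (fun _ => Metric.isClosed_closedBall.measurableSet)
    (fun i j hij => h i.2 j.2 (Subtype.coe_injective.ne hij))).trans prob_le_one

omit [SecondCountableTopology X] in
lemma exists_disjoint_closedBalls_covering (F : Set X) {r : ℝ} (hr : 0 < r) :
    ∃ u ⊆ F, (u.PairwiseDisjoint fun x => Metric.closedBall x r) ∧
      F ⊆ ⋃ x ∈ u, Metric.closedBall x (5 * r) := by
  obtain ⟨u, huF, hu, hcov⟩ := Vitali.exists_disjoint_subfamily_covering_enlargement_closedBall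
    F (fun x => x) (fun _ => r) r (fun _ _ => le_rfl) 5 (by norm_num)
  refine ⟨u, huF, hu, fun x hx => ?_⟩
  obtain ⟨b, hb, hsub⟩ := hcov x hx
  exact Set.mem_biUnion hb (hsub (Metric.mem_closedBall_self hr.le))

end Balls

/-! ### Packing measure versus masses of balls. -/

section Packing

variable {X : Type*} [PseudoMetricSpace X]

lemma dimP_le_of_packingMeasure_ne_top {F : Set X} {s : ℝ≥0}
    (h : ∀ t : ℝ≥0, s < t → packingMeasure t F ≠ ∞) : dimP F ≤ s := by
  refine iSup₂_le fun t ht => ?_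
  by_contra hlt
  exact h t (by simpa using hlt) ht

/-- The cover used is F followed by empty sets; the second summand vanishes by `packingSum_empty`.
-/
lemma packingMeasure_le_packingSum {F : Set X} {s : ℝ≥0} {δ : ℝ} (hδ : 0 < δ) :
    packingMeasure s F ≤ packingSum s δ F + ∑' _ : ℕ, packingSum s δ (∅ : Set X) := by
  refine (iInf₂_le (fun n => if n = 0 then F else ∅)
    (fun x hx => Set.mem_iUnion.2 ⟨0, by simpa using hx⟩)).trans ?_
  rw [tsum_eq_zero_add' ENNReal.summable]
  gcongr ?_ + ?_
  · dsimp only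
    rw [if_pos rfl]
    exact iInf₂_le (f := fun δ (_ : 0 < δ) => packingSum s δ F) δ hδ
  · refine ENNReal.tsum_le_tsum fun n => ?_
    dsimp only
    rw [if_neg n.succ_ne_zero]
    exact iInf₂_le (f := fun δ (_ : 0 < δ) => packingSum s δ (∅ : Set X)) δ hδ

lemma packingSum_empty {s : ℝ≥0} {δ : ℝ} : packingSum s δ (∅ : Set X) = 0 := by
  refine le_antisymm (iSup₂_le fun P hP => ?_) zero_le
  have : P = ∅ := Set.eq_empty_of_forall_notMem fun b hb => (hP.1 b hb).1
  subst this
  simp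

variable [MeasurableSpace X] [BorelSpace X]
  (μ : Measure X) [IsProbabilityMeasure μ]

/-- If the mass of every small ball centred in `F` is at least a multiple of the `s`-th power of
its radius, then `F` has packing dimension at most `s`. -/
lemma packingMeasure_ne_top_of_le_measure_closedBall {F : Set X} {s : ℝ≥0} {δ : ℝ} (hδ : 0 < δ)
    {C : ℝ≥0∞} (hC : C ≠ ∞)
    (h : ∀ x ∈ F, ∀ r, 0 < r → r ≤ δ →
      ENNReal.ofReal (2 * r) ^ (s : ℝ) ≤ C * μ (Metric.closedBall x r)) :
    packingMeasure s F ≠ ∞ := by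
  have h1 : packingSum s δ F ≤ C := by
    refine iSup₂_le fun P hP => ?_
    calc ∑' b : P, ENNReal.ofReal (2 * b.1.2) ^ (s : ℝ)
        ≤ ∑' b : P, C * μ (Metric.closedBall b.1.1 b.1.2) :=
          ENNReal.tsum_le_tsum fun b =>
            h _ (hP.1 b b.2).1 _ (hP.1 b b.2).2.1 (hP.1 b b.2).2.2
      _ = C * ∑' b : P, μ (Metric.closedBall b.1.1 b.1.2) := ENNReal.tsum_mul_left
      _ ≤ C * 1 := by
          gcongr
          exact tsum_measure_closedBall_le_one μ (x := Prod.fst) (r := Prod.snd) hP.2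
      _ = C := mul_one C
  refine ne_top_of_le_ne_top hC ((packingMeasure_le_packingSum hδ).trans ?_)
  simpa [packingSum_empty] using h1

omit [BorelSpace X] [IsProbabilityMeasure μ] in
-- Vitali: disjoint balls of radius r centred in F form a packing while their fivefold enlargements
-- cover F, whence the factor 5 in the hypothesis.
lemma measure_le_packingSum [SecondCountableTopology X] {F : Set X} {s : ℝ≥0}
    {δ r : ℝ} (hr : 0 < r) (hrδ : r ≤ δ)
    {C : ℝ≥0∞}
    (h : ∀ x, μ (Metric.closedBall x (5 * r)) ≤ C * ENNReal.ofReal (2 * r) ^ (s : ℝ)) :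
    μ F ≤ C * packingSum s δ F := by
  obtain ⟨u, huF, hu, hcov⟩ := exists_disjoint_closedBalls_covering F hr
  have hinj : Set.InjOn (fun x : X => (x, r)) u := fun x _ y _ hxy => congrArg Prod.fst hxy
  have hP : IsBallPacking δ F ((fun x => (x, r)) '' u) := by
    refine ⟨?_, ?_⟩
    · rintro _ ⟨x, hx, rfl⟩
      exact ⟨huF hx, hr, hrδ⟩
    · rw [hinj.pairwiseDisjoint_image]
      exact hu
  calc μ F ≤ ∑' x : u, μ (Metric.closedBall (x : X) (5 * r)) :=
        (measure_mono hcov).trans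
          (measure_biUnion_le μ (countable_of_pairwiseDisjoint_closedBall (fun _ _ => hr) hu) _)
    _ ≤ ∑' _ : u, C * ENNReal.ofReal (2 * r) ^ (s : ℝ) := ENNReal.tsum_le_tsum fun x => h x
    _ = C * ∑' _ : u, ENNReal.ofReal (2 * r) ^ (s : ℝ) := ENNReal.tsum_mul_left
    _ = C * ∑' b : ((fun x => (x, r)) '' u : Set (X × ℝ)),
          ENNReal.ofReal (2 * b.1.2) ^ (s : ℝ) := by
        rw [tsum_image (fun b : X × ℝ => ENNReal.ofReal (2 * b.2) ^ (s : ℝ)) hinj]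
    _ ≤ C * packingSum s δ F := by
        gcongr
        exact le_iSup₂_of_le _ hP le_rfl

omit [BorelSpace X] [IsProbabilityMeasure μ] in
/-- If there are arbitrarily small radii for which the mass of all balls of that radius is small
compared to the `s`-th power of the radius, then sets of positive mass have infinite packing
measure. -/
lemma packingMeasure_eq_top_of_measure_closedBall_le [SecondCountableTopology X]
    {A : Set X} (hA : μ A ≠ 0) {s : ℝ≥0}
    (h : ∀ ε : ℝ≥0, 0 < ε → ∀ δ : ℝ, 0 < δ → ∃ r, 0 < r ∧ r ≤ δ ∧
      ∀ x, μ (Metric.closedBall x (5 * r)) ≤ ε * ENNReal.ofReal (2 * r) ^ (s : ℝ)) :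
    packingMeasure s A = ∞ := by
  -- One member of any countable cover of A has positive mass, so an infinite premeasure on sets of
  -- positive mass suffices.
  have key (F : Set X) (hF : μ F ≠ 0) : packingPremeasure s F = ∞ := by
    refine iInf₂_eq_top.2 fun δ hδ => ?_
    by_contra hne
    refine hF (le_antisymm (ENNReal.le_of_forall_pos_le_add fun η hη _ => ?_) zero_le)
    obtain ⟨ε, hε, hle⟩ : ∃ ε : ℝ≥0, 0 < ε ∧ (ε : ℝ≥0∞) * packingSum s δ F ≤ η := by
      lift packingSum s δ F to ℝ≥0 using hne with p
      refine ⟨η / (p + 1), by positivity, ?_⟩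
      norm_cast
      rw [div_mul_eq_mul_div]
      refine div_le_of_le_mul₀ zero_le zero_le ?_
      gcongr
      simp
    obtain ⟨r, hr, hrδ, hball⟩ := h ε hε δ hδ
    rw [zero_add]
    exact (measure_le_packingSum μ hr hrδ hball).trans hle
  refine iInf₂_eq_top.2 fun G hG => ?_
  obtain ⟨i, hi⟩ : ∃ i, μ (G i) ≠ 0 := by
    by_contra! h0
    exact hA (measure_mono_null hG (measure_iUnion_null h0))
  exact ENNReal.tsum_eq_top_of_eq_top ⟨i, key _ hi⟩

end Packing

/-! ### Dimension bounds from ball masses along a discrete sequence of scales. -/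

section Scales

variable {X : Type*} [MetricSpace X] [SecondCountableTopology X] [MeasurableSpace X]
  [BorelSpace X] (μ : Measure X) [IsProbabilityMeasure μ] {ρ : ℕ → ℝ}

lemma ne_zero_of_measure_compl_eq_zero {Y : Type*} [MeasurableSpace Y] (μ : Measure Y)
    [IsProbabilityMeasure μ] {A : Set Y} (hA : μ Aᶜ = 0) : μ A ≠ 0 := fun h => by
  have := measure_union_le (μ := μ) A Aᶜ
  simp [h, hA] at this

lemma ofReal_rpow_mul {a b : ℝ} (ha : 0 ≤ a) (s : ℝ≥0) : ENNReal.ofReal (a * b) ^ (s : ℝ) =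
    ENNReal.ofReal a ^ (s : ℝ) * ENNReal.ofReal b ^ (s : ℝ) := by
  rw [ENNReal.ofReal_mul ha, ENNReal.mul_rpow_of_nonneg _ _ s.coe_nonneg]

lemma ofReal_rpow_ne_top (a : ℝ) (s : ℝ≥0) : ENNReal.ofReal a ^ (s : ℝ) ≠ ∞ :=
  ENNReal.rpow_ne_top_of_nonneg s.coe_nonneg ENNReal.ofReal_ne_top

omit [SecondCountableTopology X] in
/-- Mass distribution principle along a sequence of scales of bounded ratio. -/
lemma le_dimHMeasure_of_eventually (hρ : ∀ k, 0 < ρ k) (hρ0 : Tendsto ρ atTop (𝓝 0)) {K : ℝ}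
    (hK : ∀ k, ρ k ≤ K * ρ (k + 1)) {C : ℝ≥0∞} (hC : C ≠ ∞) {s : ℝ≥0} (hs : 0 < s)
    (h : ∀ᶠ k in atTop, ∀ x,
      μ (Metric.closedBall x (ρ k)) ≤ C * ENNReal.ofReal (ρ k) ^ (s : ℝ)) :
    s ≤ dimHMeasure μ := by
  have hKpos : 0 < K := pos_of_mul_pos_left ((hρ 0).trans_le (hK 0)) (hρ 1).le
  obtain ⟨N, hN⟩ := eventually_atTop.1 h
  -- K^s pays for rounding a diameter up to the next scale; the summand 1 makes `C'` invertible even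
  -- when C = 0.
  set C' : ℝ≥0∞ := C * ENNReal.ofReal K ^ (s : ℝ) + 1 with hC'
  have hC'top : C' ≠ ∞ :=
    ENNReal.add_ne_top.2 ⟨ENNReal.mul_ne_top hC (ofReal_rpow_ne_top _ _), ENNReal.one_ne_top⟩
  have hC'0 : C' ≠ 0 := by simp [hC']
  have hball (U : Set X) (hU : Metric.ediam U ≤ ENNReal.ofReal (ρ N)) :
      μ U ≤ C' * Metric.ediam U ^ (s : ℝ) := by
    rcases U.eq_empty_or_nonempty with rfl | ⟨x, hx⟩
    · simp
    have hfin : Metric.ediam U ≠ ∞ := ne_top_of_le_ne_top ENNReal.ofReal_ne_top hU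
    set r := (Metric.ediam U).toReal with hr
    have hUr : Metric.ediam U = ENNReal.ofReal r := (ENNReal.ofReal_toReal hfin).symm
    have hsub : ∀ R, r ≤ R → U ⊆ Metric.closedBall x R := fun R hR y hy => by
      rw [Metric.mem_closedBall]
      refine (Metric.dist_le_diam_of_mem' hfin hy hx).trans hR
    have hr0 : 0 ≤ r := ENNReal.toReal_nonneg
    rcases hr0.eq_or_lt with hr0 | hr0
    -- A set of diameter zero lies in balls of every scale, whose masses tend to 0 because s > 0.
    · have hlim : Tendsto (fun k => C * ENNReal.ofReal (ρ k) ^ (s : ℝ)) atTop (𝓝 0) := by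
        have h1 : Tendsto (fun k => ENNReal.ofReal (ρ k) ^ (s : ℝ)) atTop (𝓝 0) := by
          have := (ENNReal.continuous_rpow_const (y := (s : ℝ))).continuousAt.tendsto.comp
            (ENNReal.tendsto_ofReal hρ0)
          simpa [Function.comp_def, hs] using this
        simpa using ENNReal.Tendsto.const_mul h1 (Or.inr hC)
      have : μ U ≤ 0 := ge_of_tendsto hlim (eventually_atTop.2 ⟨N, fun k hk =>
        (measure_mono (hsub _ (hr0 ▸ (hρ k).le))).trans (hN k hk x)⟩)
      exact this.trans zero_le
    · obtain ⟨k, hNk, hk1, hk2⟩ := exists_scale hρ0 hr0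
        ((ENNReal.ofReal_le_ofReal_iff (hρ N).le).1 (hUr ▸ hU))
      calc μ U ≤ C * ENNReal.ofReal (ρ k) ^ (s : ℝ) :=
            (measure_mono (hsub _ hk2)).trans (hN k hNk x)
        _ ≤ C * ENNReal.ofReal (K * r) ^ (s : ℝ) := by
            gcongr
            exact (hK k).trans (by gcongr)
        _ = C * ENNReal.ofReal K ^ (s : ℝ) * Metric.ediam U ^ (s : ℝ) := by
            rw [ofReal_rpow_mul hKpos.le, hUr, mul_assoc]
        _ ≤ C' * Metric.ediam U ^ (s : ℝ) := by
            gcongr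
            exact le_self_add
  have hle : C'⁻¹ • μ ≤ μH[s] := by
    refine Measure.le_hausdorffMeasure _ _ (ENNReal.ofReal (ρ N)) (by simpa using hρ N)
      fun U hU => ?_
    rw [Measure.smul_apply, smul_eq_mul, ENNReal.inv_mul_le_iff hC'0 hC'top]
    exact hball U hU
  refine le_iInf₂ fun A hA => le_dimH_of_hausdorffMeasure_ne_zero fun h0 => ?_
  have := hle A
  rw [h0, Measure.smul_apply, smul_eq_mul, nonpos_iff_eq_zero, mul_eq_zero] at this
  rcases this with h | h
  · exact hC'top (ENNReal.inv_eq_zero.1 h)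
  · exact ne_zero_of_measure_compl_eq_zero μ hA h

/-- A set all of whose points are centres of balls of large mass, at infinitely many scales common
to all points, has small Hausdorff dimension. -/
lemma dimH_le_of_frequently (hρ : ∀ k, 0 < ρ k) (hρ0 : Tendsto ρ atTop (𝓝 0)) {L : ℝ}
    (hL : 0 < L) {E : Set X} {s : ℝ≥0}
    (h : ∃ᶠ k in atTop, ∀ x ∈ E,
      ENNReal.ofReal (ρ k) ^ (s : ℝ) ≤ μ (Metric.closedBall x (L * ρ k))) :
    dimH E ≤ s := by
  obtain ⟨φ, hφ, hφE⟩ := extraction_of_frequently_atTop h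
  choose u huE hu hcov using fun k =>
    exists_disjoint_closedBalls_covering E (mul_pos hL (hρ (φ k)))
  have hcount (k : ℕ) : Countable (u k) :=
    (countable_of_pairwiseDisjoint_closedBall
      (fun _ _ => mul_pos hL (hρ (φ k))) (hu k)).to_subtype
  have hdiam (k : ℕ) (x : X) : Metric.ediam (Metric.closedBall x (5 * (L * ρ (φ k)))) ≤
      ENNReal.ofReal (10 * L * ρ (φ k)) := by
    rw [← Metric.closedEBall_ofReal (by have := hρ (φ k); positivity)]
    refine Metric.ediam_closedEBall_le.trans ?_
    rw [← ENNReal.ofReal_ofNat, ← ENNReal.ofReal_mul (by norm_num)]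
    exact ENNReal.ofReal_le_ofReal (by linarith)
  refine dimH_le_of_hausdorffMeasure_ne_top (ne_top_of_le_ne_top
    (ofReal_rpow_ne_top (10 * L) s) ?_)
  -- At each selected scale the enlarged balls cover E, while the original balls are disjoint with
  -- total mass at most 1; each covering sum is therefore at most (10L)^s.
  refine (Measure.hausdorffMeasure_le_liminf_tsum (s : ℝ) E (l := atTop)
    (fun k => ENNReal.ofReal (10 * L * ρ (φ k))) ?_
    (fun k (x : u k) => Metric.closedBall (x : X) (5 * (L * ρ (φ k))))
    (Eventually.of_forall fun k x => hdiam k x)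
    (Eventually.of_forall fun k => (hcov k).trans (by simp))).trans ?_
  · have := (hρ0.comp hφ.tendsto_atTop).const_mul (10 * L)
    simpa [Function.comp_def] using ENNReal.tendsto_ofReal this
  · refine (liminf_le_liminf (Eventually.of_forall fun k => ?_)).trans_eq
      (liminf_const (f := (atTop : Filter ℕ)) _)
    calc ∑' x : u k, Metric.ediam (Metric.closedBall (x : X) (5 * (L * ρ (φ k)))) ^ (s : ℝ)
        ≤ ∑' x : u k, ENNReal.ofReal (10 * L) ^ (s : ℝ) *
            μ (Metric.closedBall (x : X) (L * ρ (φ k))) :=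
          ENNReal.tsum_le_tsum fun x => by
            refine (ENNReal.rpow_le_rpow (hdiam k x) s.coe_nonneg).trans ?_
            rw [ofReal_rpow_mul (a := 10 * L) (by positivity)]
            exact mul_le_mul_right (hφE k x (huE k x.2)) _
      _ = ENNReal.ofReal (10 * L) ^ (s : ℝ) *
            ∑' x : u k, μ (Metric.closedBall (x : X) (L * ρ (φ k))) := ENNReal.tsum_mul_left
      _ ≤ ENNReal.ofReal (10 * L) ^ (s : ℝ) * 1 := by
          gcongr
          exact tsum_measure_closedBall_le_one μ (x := fun x => x) (hu k)
      _ = _ := mul_one _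

omit [SecondCountableTopology X] in
-- A ball of radius r with Lρ_{k+1} < r ≤ Lρ_k contains the ball of radius Lρ_{k+1}, and the bounded
-- ratio of scales costs only a constant. Once ρ ≤ 1, exponents t > s are only easier.
lemma dimP_le_of_eventually (hρ : ∀ k, 0 < ρ k) (hρ0 : Tendsto ρ atTop (𝓝 0)) {K : ℝ}
    (hK : ∀ k, ρ k ≤ K * ρ (k + 1)) {L : ℝ} (hL : 0 < L) {E : Set X} {s : ℝ≥0}
    (h : ∀ᶠ k in atTop, ∀ x ∈ E,
      ENNReal.ofReal (ρ k) ^ (s : ℝ) ≤ μ (Metric.closedBall x (L * ρ k))) :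
    dimP E ≤ s := by
  have hKpos : 0 < K := pos_of_mul_pos_left ((hρ 0).trans_le (hK 0)) (hρ 1).le
  refine dimP_le_of_packingMeasure_ne_top fun t hst => ?_
  have hsmall : ∀ᶠ k in atTop, ρ k ≤ 1 := hρ0.eventually (Iic_mem_nhds one_pos)
  obtain ⟨N, hN⟩ := eventually_atTop.1 (h.and hsmall)
  have hLρ : Tendsto (fun k => L * ρ k) atTop (𝓝 0) := by simpa using hρ0.const_mul L
  refine packingMeasure_ne_top_of_le_measure_closedBall μ (mul_pos hL (hρ N))
    (C := ENNReal.ofReal (2 * L * K) ^ (t : ℝ)) (ofReal_rpow_ne_top _ _)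
    fun x hx r hr hrN => ?_
  obtain ⟨k, hNk, hk1, hk2⟩ := exists_scale hLρ hr hrN
  calc ENNReal.ofReal (2 * r) ^ (t : ℝ)
      ≤ ENNReal.ofReal (2 * L * K * ρ (k + 1)) ^ (t : ℝ) := by
        refine ENNReal.rpow_le_rpow (ENNReal.ofReal_le_ofReal ?_) t.coe_nonneg
        nlinarith [mul_le_mul_of_nonneg_left (hK k) hL.le]
    _ = ENNReal.ofReal (2 * L * K) ^ (t : ℝ) * ENNReal.ofReal (ρ (k + 1)) ^ (t : ℝ) :=
        ofReal_rpow_mul (by positivity) t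
    _ ≤ _ := by
        gcongr
        calc ENNReal.ofReal (ρ (k + 1)) ^ (t : ℝ) ≤ ENNReal.ofReal (ρ (k + 1)) ^ (s : ℝ) :=
              ENNReal.rpow_le_rpow_of_exponent_ge
                (by simpa using (hN (k + 1) (by omega)).2) (by exact_mod_cast hst.le)
          _ ≤ μ (Metric.closedBall x (L * ρ (k + 1))) := (hN (k + 1) (by omega)).1 x hx
          _ ≤ μ (Metric.closedBall x r) := measure_mono (Metric.closedBall_subset_closedBall hk1.le)

omit [BorelSpace X] in
-- A packing may use equal balls of a single scale, so infinitely many good scales are enough. For t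
-- < s the spare factor ρ_k^{s-t} tends to 0 and absorbs C.
lemma le_dimPMeasure_of_frequently (hρ : ∀ k, 0 < ρ k) (hρ0 : Tendsto ρ atTop (𝓝 0))
    {C : ℝ≥0∞} (hC : C ≠ ∞) {s : ℝ≥0}
    (h : ∃ᶠ k in atTop, ∀ x,
      μ (Metric.closedBall x (ρ k)) ≤ C * ENNReal.ofReal (ρ k) ^ (s : ℝ)) :
    s ≤ dimPMeasure μ := by
  refine le_iInf₂ fun A hA => ENNReal.le_of_forall_nnreal_lt fun t hts => ?_
  have hts' : t < s := by exact_mod_cast hts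
  refine le_iSup₂_of_le (f := fun (t : ℝ≥0) (_ : packingMeasure t A = ∞) => (t : ℝ≥0∞)) t
    (packingMeasure_eq_top_of_measure_closedBall_le μ
      (ne_zero_of_measure_compl_eq_zero μ hA) fun ε hε δ hδ => ?_) le_rfl
  have hlim : Tendsto (fun k => C * ENNReal.ofReal (5 / 2) ^ (t : ℝ) *
      ENNReal.ofReal (ρ k) ^ ((s - t : ℝ≥0) : ℝ)) atTop (𝓝 0) := by
    have h1 : Tendsto (fun k => ENNReal.ofReal (ρ k) ^ ((s - t : ℝ≥0) : ℝ)) atTop (𝓝 0) := by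
      have := (ENNReal.continuous_rpow_const
        (y := ((s - t : ℝ≥0) : ℝ))).continuousAt.tendsto.comp (ENNReal.tendsto_ofReal hρ0)
      have hpos : (0 : ℝ) < ((s - t : ℝ≥0) : ℝ) := by exact_mod_cast tsub_pos_of_lt hts'
      rwa [ENNReal.ofReal_zero, ENNReal.zero_rpow_of_pos hpos] at this
    simpa using ENNReal.Tendsto.const_mul h1
      (Or.inr (ENNReal.mul_ne_top hC (ofReal_rpow_ne_top _ _)))
  have hsmall : ∀ᶠ k in atTop, ρ k ≤ δ := hρ0.eventually (Iic_mem_nhds hδ)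
  have hε' : ∀ᶠ k in atTop, C * ENNReal.ofReal (5 / 2) ^ (t : ℝ) *
      ENNReal.ofReal (ρ k) ^ ((s - t : ℝ≥0) : ℝ) ≤ ε :=
    hlim.eventually (Iic_mem_nhds (by simpa using hε))
  obtain ⟨k, hk, hkε, hkδ⟩ := (h.and_eventually (hε'.and hsmall)).exists
  have hρk := hρ k
  -- The fivefold enlargement is then exactly the ball controlled by the hypothesis.
  refine ⟨ρ k / 5, by positivity, by linarith, fun x => ?_⟩
  have h5 : 5 * (ρ k / 5) = ρ k := by ring
  rw [h5]
  have hsplit : ENNReal.ofReal (ρ k) ^ (s : ℝ) =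
      ENNReal.ofReal (ρ k) ^ ((s - t : ℝ≥0) : ℝ) *
        (ENNReal.ofReal (5 / 2) ^ (t : ℝ) * ENNReal.ofReal (2 * (ρ k / 5)) ^ (t : ℝ)) := by
    rw [← ofReal_rpow_mul (by norm_num)]
    have h52 : (5 / 2 : ℝ) * (2 * (ρ k / 5)) = ρ k := by ring
    rw [h52, ← ENNReal.rpow_add _ _ (by simpa using hρk) ENNReal.ofReal_ne_top, ← NNReal.coe_add,
      tsub_add_cancel_of_le hts'.le]
  calc μ (Metric.closedBall x (ρ k)) ≤ C * ENNReal.ofReal (ρ k) ^ (s : ℝ) := hk x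
    _ = C * ENNReal.ofReal (5 / 2) ^ (t : ℝ) * ENNReal.ofReal (ρ k) ^ ((s - t : ℝ≥0) : ℝ) *
          ENNReal.ofReal (2 * (ρ k / 5)) ^ (t : ℝ) := by
        rw [hsplit]
        ring
    _ ≤ ε * ENNReal.ofReal (2 * (ρ k / 5)) ^ (t : ℝ) := by gcongr

end Scales

/-! ### Measures whose ball masses do not depend on the centre. -/

section Homogeneous

variable {X : Type*} [MetricSpace X] [SecondCountableTopology X] [MeasurableSpace X]
  [BorelSpace X] (μ : Measure X) [IsProbabilityMeasure μ] {ρ : ℕ → ℝ} {q : ℕ → ℝ≥0∞}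
  {E : Set X} {K L : ℝ} {C : ℝ≥0∞}

/-- If the mass of balls at scale `ρ k` centred in `E` is comparable to a number `q k` independent
of the centre, then the Hausdorff dimensions of `μ` and `E` agree. -/
lemma dimH_le_dimHMeasure_of_homogeneous (hρ : ∀ k, 0 < ρ k) (hρ0 : Tendsto ρ atTop (𝓝 0))
    (hK : ∀ k, ρ k ≤ K * ρ (k + 1)) (hL : 0 < L) (hC : C ≠ ∞)
    (hupper : ∀ k x, μ (Metric.closedBall x (ρ k)) ≤ C * q k)
    (hlower : ∀ᶠ k in atTop, ∀ x ∈ E, q k ≤ μ (Metric.closedBall x (L * ρ k))) :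
    dimH E ≤ dimHMeasure μ := by
  by_contra! hlt
  obtain ⟨s, hs1, hs2⟩ := ENNReal.lt_iff_exists_nnreal_btwn.1 hlt
  -- For s strictly between the two dimensions, either alternative is contradictory: the first gives
  -- s ≤ dim μ by mass distribution, the second dim E ≤ s by economical covers.
  by_cases h : ∀ᶠ k in atTop, q k ≤ ENNReal.ofReal (ρ k) ^ (s : ℝ)
  · refine hs1.not_ge (le_dimHMeasure_of_eventually μ hρ hρ0 hK hC
      (by simpa using zero_le.trans_lt hs1) ?_)
    filter_upwards [h] with k hk x
    exact (hupper k x).trans (by gcongr)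
  · refine hs2.not_ge (dimH_le_of_frequently μ hρ hρ0 hL ?_)
    refine ((not_eventually.1 h).and_eventually hlower).mono fun k hk x hx => ?_
    exact (not_le.1 hk.1).le.trans (hk.2 x hx)

/-- If the mass of balls at scale `ρ k` centred in `E` is comparable to a number `q k` independent
of the centre, then the packing dimensions of `μ` and `E` agree. -/
lemma dimP_le_dimPMeasure_of_homogeneous (hρ : ∀ k, 0 < ρ k) (hρ0 : Tendsto ρ atTop (𝓝 0))
    (hK : ∀ k, ρ k ≤ K * ρ (k + 1)) (hL : 0 < L) (hC : C ≠ ∞)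
    (hupper : ∀ k x, μ (Metric.closedBall x (ρ k)) ≤ C * q k)
    (hlower : ∀ᶠ k in atTop, ∀ x ∈ E, q k ≤ μ (Metric.closedBall x (L * ρ k))) :
    dimP E ≤ dimPMeasure μ := by
  by_contra! hlt
  obtain ⟨s, hs1, hs2⟩ := ENNReal.lt_iff_exists_nnreal_btwn.1 hlt
  -- The Hausdorff dichotomy with "eventually" and "infinitely often" exchanged.
  by_cases h : ∃ᶠ k in atTop, q k ≤ ENNReal.ofReal (ρ k) ^ (s : ℝ)
  · refine hs1.not_ge (le_dimPMeasure_of_frequently μ hρ hρ0 hC (h.mono fun k hk x => ?_))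
    exact (hupper k x).trans (by gcongr)
  · refine hs2.not_ge (dimP_le_of_eventually μ hρ hρ0 hK hL ?_)
    filter_upwards [not_frequently.1 h, hlower] with k hk hk' x hx
    exact (not_le.1 hk).le.trans (hk' x hx)

end Homogeneous

/-! ### Digit expansions in varying bases -/

/-- The integer with digits `d 0, …, d (k - 1)`, most significant first, in the mixed radix
system with bases `b`. -/
def mixedRadix (b d : ℕ → ℕ) : ℕ → ℕ
  | 0 => 0
  | k + 1 => b k * mixedRadix b d k + d k

section MixedRadix

variable {b d d' : ℕ → ℕ}

lemma mixedRadix_congr {k : ℕ} (h : ∀ j < k, d j = d' j) :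
    mixedRadix b d k = mixedRadix b d' k := by
  induction k with
  | zero => rfl
  | succ k ih =>
    rw [mixedRadix, mixedRadix, ih fun j hj => h j (by omega), h k (by omega)]

/-- The last digit is the residue modulo `b k`, and the quotient carries the earlier digits. -/
lemma eq_of_mixedRadix_eq (hd : ∀ k, d k < b k) (hd' : ∀ k, d' k < b k) {k : ℕ}
    (h : mixedRadix b d k = mixedRadix b d' k) : ∀ j < k, d j = d' j := by
  induction k with
  | zero => simp
  | succ k ih =>
    rw [mixedRadix, mixedRadix] at h
    have h1 := congrArg (· % b k) h
    have h2 := congrArg (· / b k) h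
    have hb : 0 < b k := (Nat.zero_le _).trans_lt (hd k)
    simp only [Nat.mul_add_mod, Nat.mod_eq_of_lt (hd k), Nat.mod_eq_of_lt (hd' k)] at h1
    simp only [Nat.mul_add_div hb, Nat.div_eq_of_lt (hd k), Nat.div_eq_of_lt (hd' k),
      add_zero] at h2
    intro j hj
    rcases Nat.lt_succ_iff_lt_or_eq.1 hj with hj | rfl
    · exact ih h2 j hj
    · exact h1

variable (b) in
/-- The number of cells of level `k` of the unit interval. -/
def baseProd (k : ℕ) : ℕ := ∏ h ∈ Finset.range k, b h

lemma baseProd_succ (k : ℕ) : baseProd b (k + 1) = baseProd b k * b k := Finset.prod_range_succ _ _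

lemma baseProd_pos (hb : ∀ k, 0 < b k) (k : ℕ) : 0 < baseProd b k :=
  Finset.prod_pos fun h _ => hb h

lemma two_pow_le_baseProd (hb : ∀ k, 2 ≤ b k) (k : ℕ) : 2 ^ k ≤ baseProd b k := by
  simpa [baseProd] using Finset.pow_card_le_prod (Finset.range k) b 2 fun h _ => hb h

/-- Together with `antitone_mixedRadix_add_one_div` this says that the cells of successive levels
are nested: left endpoints increase, right endpoints decrease. -/
lemma monotone_mixedRadix_div (hb : ∀ k, 0 < b k) :
    Monotone fun k => (mixedRadix b d k : ℝ) / baseProd b k := by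
  refine monotone_nat_of_le_succ fun k => ?_
  have h1 : (0 : ℝ) < baseProd b k := by exact_mod_cast baseProd_pos hb k
  have h2 : (0 : ℝ) < b k := by exact_mod_cast hb k
  rw [mixedRadix, baseProd_succ, div_le_div_iff₀ h1 (by push_cast; positivity)]
  push_cast
  have : (0 : ℝ) ≤ d k * baseProd b k := by positivity
  linarith

lemma antitone_mixedRadix_add_one_div (hd : ∀ k, d k < b k) :
    Antitone fun k => ((mixedRadix b d k : ℝ) + 1) / baseProd b k := by
  have hb : ∀ k, 0 < b k := fun k => (Nat.zero_le _).trans_lt (hd k)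
  refine antitone_nat_of_succ_le fun k => ?_
  have h1 : (0 : ℝ) < baseProd b k := by exact_mod_cast baseProd_pos hb k
  have h2 : (0 : ℝ) < b k := by exact_mod_cast hb k
  have h3 : (d k : ℝ) + 1 ≤ b k := by exact_mod_cast hd k
  rw [mixedRadix, baseProd_succ, div_le_div_iff₀ (by push_cast; positivity) h1]
  push_cast
  nlinarith [mul_le_mul_of_nonneg_right h3 h1.le]

lemma sum_digits_eq (hb : ∀ k, 0 < b k) (k : ℕ) :
    ∑ j ∈ Finset.range k, (∏ h ∈ Finset.range (j + 1), (b h : ℝ)⁻¹) * (d j : ℝ) =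
      mixedRadix b d k / baseProd b k := by
  induction k with
  | zero => simp [mixedRadix]
  | succ k ih =>
    have h1 : (baseProd b k : ℝ) ≠ 0 := by exact_mod_cast (baseProd_pos hb k).ne'
    have h2 : (b k : ℝ) ≠ 0 := by exact_mod_cast (hb k).ne'
    have h3 : ∏ h ∈ Finset.range (k + 1), (b h : ℝ)⁻¹ = (baseProd b (k + 1) : ℝ)⁻¹ := by
      simp [baseProd]
    rw [Finset.sum_range_succ, ih, h3, baseProd_succ, mixedRadix]
    push_cast
    field_simp

lemma tsum_digits_mem_Icc (hb : ∀ k, 2 ≤ b k) (hd : ∀ k, d k < b k) (k : ℕ) :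
    ∑' j, (∏ h ∈ Finset.range (j + 1), (b h : ℝ)⁻¹) * (d j : ℝ) ∈
      Set.Icc ((mixedRadix b d k : ℝ) / baseProd b k)
        (((mixedRadix b d k : ℝ) + 1) / baseProd b k) := by
  have hb' : ∀ k, 0 < b k := fun k => zero_lt_two.trans_le (hb k)
  have hlim := (MoranConstruction.summable_digits hb hd).hasSum.tendsto_sum_nat
  simp only [sum_digits_eq hb'] at hlim
  refine ⟨(monotone_mixedRadix_div hb').ge_of_tendsto hlim k, le_of_tendsto hlim ?_⟩
  filter_upwards [eventually_ge_atTop k] with j hj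
  refine le_trans ?_ (antitone_mixedRadix_add_one_div hd hj)
  dsimp only
  gcongr
  linarith

/-- An integer within distance two below and one above a real number `y` takes one of at most four
values. -/
lemma mem_Icc_floor {y : ℝ} {z : ℤ} (h1 : y - 2 ≤ z) (h2 : z ≤ y + 1) :
    z ∈ Finset.Icc (⌊y⌋ - 2) (⌊y⌋ + 1) := by
  rw [Finset.mem_Icc]
  constructor
  · have : ((⌊y⌋ - 2 : ℤ) : ℝ) ≤ z := by
      push_cast
      linarith [Int.floor_le y]
    exact_mod_cast this
  · have := Int.le_floor.2 (show ((z - 1 : ℤ) : ℝ) ≤ y by push_cast; linarith)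
    omega

end MixedRadix

/-! ### Coding of points of the Moran set by digit sequences. -/

namespace MoranConstruction

variable (S : MoranConstruction)

/-- The first coordinates of the digits of a sequence. -/
def xDigit {S : MoranConstruction} (w : S.Seq) (k : ℕ) : ℕ := (w k).1.1

/-- The second coordinates of the digits of a sequence. -/
def yDigit {S : MoranConstruction} (w : S.Seq) (k : ℕ) : ℕ := (w k).1.2

variable {S}

lemma xDigit_lt (w : S.Seq) (k : ℕ) : xDigit w k < S.n k := by
  have := S.D_subset k (w k).2
  simp only [Finset.mem_product, Finset.mem_range] at this
  exact this.1

lemma yDigit_lt (w : S.Seq) (k : ℕ) : yDigit w k < S.m k := by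
  have := S.D_subset k (w k).2
  simp only [Finset.mem_product, Finset.mem_range] at this
  exact this.2

lemma n_pos (k : ℕ) : 0 < S.n k := zero_lt_two.trans_le (S.two_le_n k)

lemma m_pos (k : ℕ) : 0 < S.m k := zero_lt_two.trans_le (S.two_le_m k)

lemma cast_baseProd_n_pos (k : ℕ) : (0 : ℝ) < baseProd S.n k := by
  exact_mod_cast baseProd_pos S.n_pos k

lemma cast_baseProd_m_pos (k : ℕ) : (0 : ℝ) < baseProd S.m k := by
  exact_mod_cast baseProd_pos S.m_pos k

instance nonempty_digit (k : ℕ) : Nonempty {w : ℕ × ℕ // w ∈ S.D k} := by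
  obtain ⟨w, hw⟩ := Finset.card_pos.1 (zero_lt_two.trans_le (S.two_le_card k))
  exact ⟨⟨w, hw⟩⟩

lemma proj_zero_mem (w : S.Seq) (k : ℕ) : S.proj w 0 ∈
    Set.Icc ((mixedRadix S.n (xDigit w) k : ℝ) / baseProd S.n k)
      (((mixedRadix S.n (xDigit w) k : ℝ) + 1) / baseProd S.n k) := by
  simpa [proj, xDigit] using tsum_digits_mem_Icc S.two_le_n (xDigit_lt w) k

lemma proj_one_mem (w : S.Seq) (k : ℕ) : S.proj w 1 ∈
    Set.Icc ((mixedRadix S.m (yDigit w) k : ℝ) / baseProd S.m k)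
      (((mixedRadix S.m (yDigit w) k : ℝ) + 1) / baseProd S.m k) := by
  simpa [proj, yDigit] using tsum_digits_mem_Icc S.two_le_m (yDigit_lt w) k

lemma wordMap_eq (v : S.Seq) (k : ℕ) (x : EuclideanSpace ℝ (Fin 2)) :
    S.wordMap k (fun j => v j) x =
      !₂[(mixedRadix S.n (xDigit v) k + x 0) / baseProd S.n k,
        (mixedRadix S.m (yDigit v) k + x 1) / baseProd S.m k] := by
  induction k generalizing x with
  | zero =>
    ext i
    fin_cases i <;> simp [wordMap, mixedRadix, baseProd]
  | succ k ih =>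
    have h : S.wordMap (k + 1) (fun j => v j) x =
      S.wordMap k (fun j => v j) (S.digitMap k (v k) x) := rfl
    have hn : (S.n k : ℝ) ≠ 0 := by exact_mod_cast (S.n_pos k).ne'
    have hm : (S.m k : ℝ) ≠ 0 := by exact_mod_cast (S.m_pos k).ne'
    have hA := (S.cast_baseProd_n_pos k).ne'
    have hB := (S.cast_baseProd_m_pos k).ne'
    rw [h, ih]
    ext i
    fin_cases i
    · simp [digitMap, mixedRadix, baseProd_succ, xDigit]
      field_simp
      ring
    · simp [digitMap, mixedRadix, baseProd_succ, yDigit]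
      field_simp
      ring

lemma exists_seq_eq (k : ℕ) (w : S.Word k) : ∃ v : S.Seq, (fun j : Fin k => v j) = w := by
  refine ⟨fun j => if h : j < k then w ⟨j, h⟩ else Classical.arbitrary _, ?_⟩
  ext1 j
  simp

lemma proj_mem_moranSet (w : S.Seq) : S.proj w ∈ S.moranSet := by
  -- The preimage in the unit square is found by blowing the level k cell up to unit size.
  refine Set.mem_iInter₂.2 fun k _ => Set.mem_iUnion.2 ⟨fun j => w j,
    !₂[S.proj w 0 * baseProd S.n k - mixedRadix S.n (xDigit w) k,
      S.proj w 1 * baseProd S.m k - mixedRadix S.m (yDigit w) k], ?_, ?_⟩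
  · have h0 := proj_zero_mem w k
    have h1 := proj_one_mem w k
    rw [Set.mem_Icc, div_le_iff₀ (S.cast_baseProd_n_pos k),
      le_div_iff₀ (S.cast_baseProd_n_pos k)] at h0
    rw [Set.mem_Icc, div_le_iff₀ (S.cast_baseProd_m_pos k),
      le_div_iff₀ (S.cast_baseProd_m_pos k)] at h1
    intro i
    fin_cases i
    · simp only [Fin.zero_eta, Matrix.cons_val_zero, Set.mem_Icc]
      constructor <;> linarith
    · simp only [Fin.mk_one, Matrix.cons_val_one, Matrix.cons_val_fin_one,
        Set.mem_Icc]
      constructor <;> linarith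
  · have hA := (S.cast_baseProd_n_pos k).ne'
    have hB := (S.cast_baseProd_m_pos k).ne'
    rw [wordMap_eq]
    ext i
    fin_cases i <;> simp [hA, hB]

/-- The sequence may depend on k, so a point of E need not be written as a value of `proj`.
Horizontal cells are needed at every l ≤ k because approximate squares use the coarser level
`columnLevel k`. -/
lemma exists_seq_of_mem_moranSet {x : EuclideanSpace ℝ (Fin 2)} (hx : x ∈ S.moranSet) {k : ℕ}
    (hk : 1 ≤ k) : ∃ v : S.Seq,
      (∀ l ≤ k, x 0 ∈ Set.Icc ((mixedRadix S.n (xDigit v) l : ℝ) / baseProd S.n l)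
        (((mixedRadix S.n (xDigit v) l : ℝ) + 1) / baseProd S.n l)) ∧
      x 1 ∈ Set.Icc ((mixedRadix S.m (yDigit v) k : ℝ) / baseProd S.m k)
        (((mixedRadix S.m (yDigit v) k : ℝ) + 1) / baseProd S.m k) := by
  obtain ⟨w, y, hy, rfl⟩ := Set.mem_iUnion.1 (Set.mem_iInter₂.1 hx k hk)
  obtain ⟨v, rfl⟩ := exists_seq_eq k w
  have hA := S.cast_baseProd_n_pos k
  have hB := S.cast_baseProd_m_pos k
  have h0 := hy 0
  have h1 := hy 1
  rw [Set.mem_Icc] at h0 h1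
  refine ⟨v, fun l hl => ?_, ?_⟩
  · have hl1 := monotone_mixedRadix_div (d := xDigit v) S.n_pos hl
    have hl2 := antitone_mixedRadix_add_one_div (xDigit_lt v) hl
    dsimp only at hl1 hl2
    rw [wordMap_eq]
    simp only [Matrix.cons_val_zero]
    constructor
    · refine hl1.trans ?_
      gcongr
      linarith
    · refine le_trans ?_ hl2
      gcongr
      linarith
  · rw [wordMap_eq]
    simp only [Matrix.cons_val_one, Matrix.cons_val_fin_one]
    constructor
    · gcongr
      linarith
    · gcongr
      linarith

lemma isCompact_unitSquare : IsCompact unitSquare := by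
  have h : unitSquare = WithLp.toLp 2 '' Set.univ.pi fun _ : Fin 2 => Set.Icc (0 : ℝ) 1 := by
    ext x
    constructor
    · exact fun hx => ⟨x.ofLp, fun i _ => hx i, rfl⟩
    · rintro ⟨y, hy, rfl⟩ i
      exact hy i trivial
  rw [h]
  exact (isCompact_univ_pi fun _ => isCompact_Icc).image (PiLp.continuous_toLp 2 _)

lemma continuous_wordMap (k : ℕ) (w : S.Word k) : Continuous (S.wordMap k w) := by
  obtain ⟨v, rfl⟩ := exists_seq_eq k w
  rw [funext (wordMap_eq v k)]
  refine (PiLp.continuous_toLp 2 _).comp (continuous_pi fun i => ?_)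
  fin_cases i <;> simp <;> fun_prop

lemma measurableSet_moranSet : MeasurableSet S.moranSet :=
  .iInter fun k => .iInter fun _ => .iUnion fun w =>
    (isCompact_unitSquare.image (continuous_wordMap k w)).isClosed.measurableSet

lemma moranMeasure_compl_moranSet (p : S.Weights) : S.moranMeasure p S.moranSetᶜ = 0 := by
  rw [moranMeasure, Measure.map_apply S.measurable_proj measurableSet_moranSet.compl]
  convert measure_empty (μ := S.symbolicMeasure p)
  exact Set.eq_empty_of_forall_notMem fun w hw => hw (proj_mem_moranSet w)

/-! ### Approximate squares -/

/-- The sequences that agree with `v` in the first `l` digits, and in the second coordinates of the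
first `k` digits. -/
def approxSquare (v : S.Seq) (l k : ℕ) : Set S.Seq :=
  {w | (∀ h < l, w h = v h) ∧ ∀ h < k, yDigit w h = yDigit v h}

variable (S) in
/-- The uniform weights `p k w = 1 / card (D k)`. -/
noncomputable def uniformWeights : S.Weights := fun _ => PMF.uniformOfFintype _

lemma uniformWeights_apply (k : ℕ) (w : {w : ℕ × ℕ // w ∈ S.D k}) :
    S.uniformWeights k w = ((S.D k).card : ℝ≥0∞)⁻¹ := by
  simp [uniformWeights]

variable (S) in
/-- The common mass of the approximate squares with respect to uniform weights, when all nonempty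
rows of `D k` have `c k` elements. -/
noncomputable def approxSquareMass (c : ℕ → ℕ) (l k : ℕ) : ℝ≥0∞ :=
  ∏ h ∈ Finset.range k, ((if h < l then 1 else c h : ℕ) : ℝ≥0∞) / (S.D h).card

lemma uniformWeights_row (k : ℕ) (v : {w : ℕ × ℕ // w ∈ S.D k}) :
    (S.uniformWeights k).toMeasure {u | u.1.2 = v.1.2} =
      (S.rowCard k v.1.2 : ℝ≥0∞) / (S.D k).card := by
  classical
  rw [uniformWeights, PMF.toMeasure_uniformOfFintype_apply _ .of_discrete, Fintype.card_coe]
  congr 2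
  rw [rowCard, Fintype.card_subtype]
  refine Finset.card_bij (fun u _ => u.1) ?_ ?_ ?_
  · intro u hu
    simp only [Finset.mem_filter, Finset.mem_univ, true_and, Set.mem_ofPred_eq] at hu
    exact Finset.mem_filter.2 ⟨u.2, hu⟩
  · exact fun u _ u' _ h => Subtype.ext h
  · intro w hw
    rw [Finset.mem_filter] at hw
    exact ⟨⟨w, hw.1⟩, by simpa using hw.2, rfl⟩

/-- An approximate square is a product set, with a point at levels below l and a full row from l to
k. Each such row contains the digit of v, so it is nonempty and has c_h elements whatever v is. -/
lemma symbolicMeasure_approxSquare {c : ℕ → ℕ}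
    (hc : ∀ k j, S.rowCard k j ≠ 0 → S.rowCard k j = c k) (v : S.Seq) {l k : ℕ} (hlk : l ≤ k) :
    S.symbolicMeasure S.uniformWeights (approxSquare v l k) = S.approxSquareMass c l k := by
  have h : approxSquare v l k = Set.pi (Finset.range k : Set ℕ)
      fun h => if h < l then {v h} else {u | u.1.2 = (v h).1.2} := by
    ext w
    simp only [approxSquare, Set.mem_ofPred_eq, Set.mem_pi, Finset.coe_range, Set.mem_Iio]
    constructor
    · rintro ⟨h1, h2⟩ h hh
      split_ifs with hl
      · exact h1 h hl
      · exact h2 h hh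
    · refine fun hw => ⟨fun h hh => ?_, fun h hh => ?_⟩
      · have := hw h (hh.trans_le hlk)
        rwa [if_pos hh] at this
      · have := hw h hh
        split_ifs at this with hl
        · rw [Set.mem_singleton_iff] at this
          rw [yDigit, this, yDigit]
        · exact this
  rw [h, symbolicMeasure, Measure.infinitePi_pi _ fun _ _ => .of_discrete, approxSquareMass]
  refine Finset.prod_congr rfl fun h _ => ?_
  split_ifs with hl
  · rw [PMF.toMeasure_apply_singleton _ _ .of_discrete, uniformWeights_apply]
    simp
  · rw [uniformWeights_row, hc]
    rw [rowCard, Finset.card_ne_zero]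
    exact ⟨(v h).1, Finset.mem_filter.2 ⟨(v h).2, rfl⟩⟩

/-! ### Balls compared with approximate squares. -/

variable (S) in
/-- The greatest `l ≤ k` for which the columns of level `l` are at least as wide as the rows of
level `k` are high. -/
noncomputable def columnLevel (k : ℕ) : ℕ :=
  Nat.findGreatest (fun l => baseProd S.n l ≤ baseProd S.m k) k

lemma columnLevel_le (k : ℕ) : S.columnLevel k ≤ k := Nat.findGreatest_le k

lemma baseProd_columnLevel_le (k : ℕ) : baseProd S.n (S.columnLevel k) ≤ baseProd S.m k :=
  Nat.findGreatest_spec (P := fun l => baseProd S.n l ≤ baseProd S.m k) (Nat.zero_le k)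
    (baseProd_pos S.m_pos k)

/-- If the level is below k, maximality means that one more factor, at most K, exceeds M_k; if it is
capped at k, then M_k ≤ N_k. -/
lemma baseProd_le_mul_columnLevel (hnm : ∀ k, S.m k ≤ S.n k) {K : ℕ} (hK : ∀ k, S.n k ≤ K)
    (k : ℕ) : baseProd S.m k ≤ K * baseProd S.n (S.columnLevel k) := by
  rcases (columnLevel_le (S := S) k).eq_or_lt with h | h
  · rw [h]
    calc baseProd S.m k ≤ baseProd S.n k := Finset.prod_le_prod' fun h _ => hnm h
      _ ≤ K * baseProd S.n k := Nat.le_mul_of_pos_left _ ((S.n_pos 0).trans_le (hK 0))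
  · have := Nat.findGreatest_is_greatest (Nat.lt_succ_self (S.columnLevel k)) h
    rw [not_le, Nat.succ_eq_add_one, baseProd_succ] at this
    calc baseProd S.m k ≤ baseProd S.n (S.columnLevel k) * S.n (S.columnLevel k) := this.le
      _ ≤ baseProd S.n (S.columnLevel k) * K := Nat.mul_le_mul_left _ (hK _)
      _ = _ := mul_comm _ _

/-- Cells are counted symbolically, by the integers that name their column and row. A ball allows
four values for each, hence 16 cells, and overlaps of their images are harmless. -/
lemma moranMeasure_closedBall_le {c : ℕ → ℕ}
    (hc : ∀ k j, S.rowCard k j ≠ 0 → S.rowCard k j = c k) (k : ℕ)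
    (x : EuclideanSpace ℝ (Fin 2)) :
    S.moranMeasure S.uniformWeights (Metric.closedBall x (baseProd S.m k : ℝ)⁻¹) ≤
      16 * S.approxSquareMass c (S.columnLevel k) k := by
  set l := S.columnLevel k
  have hA := S.cast_baseProd_n_pos l
  have hB := S.cast_baseProd_m_pos k
  have hAB : (baseProd S.n l : ℝ) ≤ baseProd S.m k := by
    exact_mod_cast baseProd_columnLevel_le (S := S) k
  let cell (z : ℤ × ℤ) : Set S.Seq :=
    {w | (mixedRadix S.n (xDigit w) l : ℤ) = z.1 ∧ (mixedRadix S.m (yDigit w) k : ℤ) = z.2}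
  have hcell (z : ℤ × ℤ) :
      S.symbolicMeasure S.uniformWeights (cell z) ≤ S.approxSquareMass c l k := by
    rcases (cell z).eq_empty_or_nonempty with h | ⟨v, hv1, hv2⟩
    · simp [h]
    · rw [← symbolicMeasure_approxSquare hc v (columnLevel_le k)]
      refine measure_mono fun w ⟨hw1, hw2⟩ => ?_
      have hX := eq_of_mixedRadix_eq (xDigit_lt w) (xDigit_lt v) (k := l)
        (by exact_mod_cast hw1.trans hv1.symm)
      have hY := eq_of_mixedRadix_eq (yDigit_lt w) (yDigit_lt v) (k := k)
        (by exact_mod_cast hw2.trans hv2.symm)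
      exact ⟨fun h hh => Subtype.ext (Prod.ext (hX h hh) (hY h (hh.trans_le (columnLevel_le k)))),
        hY⟩
  let I (y : ℝ) : Finset ℤ := Finset.Icc (⌊y⌋ - 2) (⌊y⌋ + 1)
  have hI (y : ℝ) : (I y).card = 4 := by
    simp only [I, Int.card_Icc]
    omega
  let t := I (x 0 * baseProd S.n l) ×ˢ I (x 1 * baseProd S.m k)
  have hsub : S.proj ⁻¹' Metric.closedBall x (baseProd S.m k : ℝ)⁻¹ ⊆ ⋃ z ∈ t, cell z := by
    intro w hw
    rw [Set.mem_preimage, Metric.mem_closedBall] at hw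
    have hcoord (i : Fin 2) : |S.proj w i - x i| ≤ (baseProd S.m k : ℝ)⁻¹ := by
      have := PiLp.dist_apply_le (S.proj w) x i
      rw [Real.dist_eq] at this
      exact this.trans hw
    -- After scaling by a, y·a lies in [X, X+1] and differs from y'·a by at most 1, so X lies
    -- between y'·a − 2 and y'·a + 1.
    have hbound {y y' a X : ℝ} (ha : 0 < a) (haB : a ≤ baseProd S.m k)
        (hy : |y - y'| ≤ (baseProd S.m k : ℝ)⁻¹) (hX : y ∈ Set.Icc (X / a) ((X + 1) / a)) :
        y' * a - 2 ≤ X ∧ X ≤ y' * a + 1 := by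
      rw [Set.mem_Icc, div_le_iff₀ ha, le_div_iff₀ ha] at hX
      have h1 : (baseProd S.m k : ℝ)⁻¹ * a ≤ 1 := (inv_mul_le_one₀ hB).2 haB
      have h2 := abs_le.1 hy
      constructor <;> nlinarith
    have h0 := hbound hA hAB (hcoord 0) (proj_zero_mem w l)
    have h1 := hbound hB le_rfl (hcoord 1) (proj_one_mem w k)
    refine Set.mem_biUnion (x := ((mixedRadix S.n (xDigit w) l : ℤ),
      (mixedRadix S.m (yDigit w) k : ℤ))) (Finset.mem_coe.2 (Finset.mem_product.2 ⟨?_, ?_⟩))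
      ⟨rfl, rfl⟩
    · exact mem_Icc_floor (by exact_mod_cast h0.1) (by exact_mod_cast h0.2)
    · exact mem_Icc_floor (by exact_mod_cast h1.1) (by exact_mod_cast h1.2)
  rw [moranMeasure, Measure.map_apply S.measurable_proj Metric.isClosed_closedBall.measurableSet]
  calc S.symbolicMeasure S.uniformWeights (S.proj ⁻¹' Metric.closedBall x (baseProd S.m k : ℝ)⁻¹)
      ≤ ∑ z ∈ t, S.symbolicMeasure S.uniformWeights (cell z) :=
        (measure_mono hsub).trans (measure_biUnion_finset_le t cell)
    _ ≤ ∑ _z ∈ t, S.approxSquareMass c l k := Finset.sum_le_sum fun z _ => hcell z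
    _ = 16 * S.approxSquareMass c l k := by
        rw [Finset.sum_const, Finset.card_product, hI, hI, nsmul_eq_mul]
        norm_num

/-- If v codes x up to level k, the approximate square of v projects to points within 1/N_l ≤ K/M_k
of x horizontally and 1/M_k vertically, hence the radius (K+1)/M_k. -/
lemma le_moranMeasure_closedBall {c : ℕ → ℕ}
    (hc : ∀ k j, S.rowCard k j ≠ 0 → S.rowCard k j = c k) (hnm : ∀ k, S.m k ≤ S.n k) {K : ℕ}
    (hK : ∀ k, S.n k ≤ K) {k : ℕ} (hk : 1 ≤ k) {x : EuclideanSpace ℝ (Fin 2)}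
    (hx : x ∈ S.moranSet) :
    S.approxSquareMass c (S.columnLevel k) k ≤
      S.moranMeasure S.uniformWeights
        (Metric.closedBall x ((K + 1) * (baseProd S.m k : ℝ)⁻¹)) := by
  obtain ⟨v, hv0, hv1⟩ := exists_seq_of_mem_moranSet hx hk
  set l := S.columnLevel k
  have hA := S.cast_baseProd_n_pos l
  have hB := S.cast_baseProd_m_pos k
  have hAB : (baseProd S.m k : ℝ) ≤ K * baseProd S.n l := by
    exact_mod_cast baseProd_le_mul_columnLevel hnm hK k
  rw [moranMeasure, Measure.map_apply S.measurable_proj Metric.isClosed_closedBall.measurableSet,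
    ← symbolicMeasure_approxSquare hc v (columnLevel_le k)]
  refine measure_mono fun w ⟨hw1, hw2⟩ => ?_
  have hw0 := proj_zero_mem w l
  have hw1' := proj_one_mem w k
  rw [mixedRadix_congr (d' := xDigit v) fun h hh => by rw [xDigit, hw1 h hh, xDigit]] at hw0
  rw [mixedRadix_congr (d' := yDigit v) hw2] at hw1'
  have hdist {y y' a X : ℝ} (hy : y ∈ Set.Icc (X / a) ((X + 1) / a))
      (hy' : y' ∈ Set.Icc (X / a) ((X + 1) / a)) : |y - y'| ≤ a⁻¹ := by
    rw [Set.mem_Icc, add_div, one_div] at hy hy'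
    exact abs_le.2 ⟨by linarith, by linarith⟩
  have h0 := hdist hw0 (hv0 l (columnLevel_le k))
  have h1 := hdist hw1' hv1
  have hAK : (baseProd S.n l : ℝ)⁻¹ ≤ K * (baseProd S.m k : ℝ)⁻¹ := by
    rw [← div_eq_mul_inv, le_div_iff₀ hB, inv_mul_le_iff₀ hA, mul_comm]
    exact hAB
  rw [Set.mem_preimage, Metric.mem_closedBall, EuclideanSpace.dist_eq, Fin.sum_univ_two,
    Real.dist_eq, Real.dist_eq]
  refine Real.sqrt_le_iff.2 ⟨by positivity, ?_⟩
  have h0' := h0.trans hAK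
  have hn0 := abs_nonneg (S.proj w 0 - x 0)
  have hn1 := abs_nonneg (S.proj w 1 - x 1)
  calc |S.proj w 0 - x 0| ^ 2 + |S.proj w 1 - x 1| ^ 2
      ≤ (|S.proj w 0 - x 0| + |S.proj w 1 - x 1|) ^ 2 := by nlinarith
    _ ≤ ((K + 1) * (baseProd S.m k : ℝ)⁻¹) ^ 2 := by
        gcongr
        linarith

/-! ### The scales 1/M_k and the equality of dimensions. -/

lemma tendsto_inv_baseProd_m :
    Tendsto (fun k => (baseProd S.m k : ℝ)⁻¹) atTop (𝓝 0) := by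
  refine squeeze_zero (fun k => by positivity) (fun k => ?_)
    (tendsto_pow_atTop_nhds_zero_of_lt_one (r := (2 : ℝ)⁻¹) (by norm_num) (by norm_num))
  rw [inv_pow]
  have : (2 : ℝ) ^ k ≤ baseProd S.m k := by exact_mod_cast two_pow_le_baseProd S.two_le_m k
  gcongr

lemma inv_baseProd_m_le {K : ℕ} (hK : ∀ k, S.m k ≤ K) (k : ℕ) :
    (baseProd S.m k : ℝ)⁻¹ ≤ K * (baseProd S.m (k + 1) : ℝ)⁻¹ := by
  have h1 := S.cast_baseProd_m_pos k
  have h2 : (0 : ℝ) < S.m k := by exact_mod_cast S.m_pos k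
  have h3 : (S.m k : ℝ) ≤ K := by exact_mod_cast hK k
  rw [← div_eq_mul_inv, inv_eq_one_div, baseProd_succ,
    div_le_div_iff₀ h1 (by push_cast; positivity)]
  push_cast
  nlinarith

lemma dimHMeasure_le (p : S.Weights) : dimHMeasure (S.moranMeasure p) ≤ dimH S.moranSet :=
  iInf₂_le (f := fun A (_ : S.moranMeasure p Aᶜ = 0) => dimH A) _ (moranMeasure_compl_moranSet p)

lemma dimHMeasure_uniformWeights {K : ℕ} (hKn : ∀ k, S.n k ≤ K) (hnm : ∀ k, S.m k ≤ S.n k)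
    {c : ℕ → ℕ} (hc : ∀ k j, S.rowCard k j ≠ 0 → S.rowCard k j = c k) :
    dimHMeasure (S.moranMeasure S.uniformWeights) = dimH S.moranSet :=
  (dimHMeasure_le _).antisymm (dimH_le_dimHMeasure_of_homogeneous _
    (fun k => inv_pos.2 (S.cast_baseProd_m_pos k)) tendsto_inv_baseProd_m
    (inv_baseProd_m_le fun k => (hnm k).trans (hKn k)) (L := (K : ℝ) + 1) (by positivity)
    (ENNReal.ofNat_ne_top (n := 16)) (moranMeasure_closedBall_le hc)
    ((eventually_ge_atTop 1).mono fun _ hk _ hx => le_moranMeasure_closedBall hc hnm hKn hk hx))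

lemma dimPMeasure_le (p : S.Weights) : dimPMeasure (S.moranMeasure p) ≤ dimP S.moranSet :=
  iInf₂_le (f := fun A (_ : S.moranMeasure p Aᶜ = 0) => dimP A) _ (moranMeasure_compl_moranSet p)

lemma dimPMeasure_uniformWeights {K : ℕ} (hKn : ∀ k, S.n k ≤ K) (hnm : ∀ k, S.m k ≤ S.n k)
    {c : ℕ → ℕ} (hc : ∀ k j, S.rowCard k j ≠ 0 → S.rowCard k j = c k) :
    dimPMeasure (S.moranMeasure S.uniformWeights) = dimP S.moranSet :=
  (dimPMeasure_le _).antisymm (dimP_le_dimPMeasure_of_homogeneous _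
    (fun k => inv_pos.2 (S.cast_baseProd_m_pos k)) tendsto_inv_baseProd_m
    (inv_baseProd_m_le fun k => (hnm k).trans (hKn k)) (L := (K : ℝ) + 1) (by positivity)
    (ENNReal.ofNat_ne_top (n := 16)) (moranMeasure_closedBall_le hc)
    ((eventually_ge_atTop 1).mono fun _ hk _ hx => le_moranMeasure_closedBall hc hnm hKn hk hx))

end MoranConstruction

theorem corollary4p2 (S : MoranConstruction)
    (hN : BddAbove (Set.range S.n ∪ Set.range S.m))
    (hBSC : S.BSC)
    (hnm : ∀ k, S.m k ≤ S.n k)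
    (c : ℕ → ℕ) (hc : ∀ k j, S.rowCard k j ≠ 0 → S.rowCard k j = c k) :
    ∃ p : S.Weights,
      (∀ k w, p k w = ((S.D k).card : ℝ≥0∞)⁻¹) ∧
      (IsGreatest (Set.range fun p' : S.Weights => dimHMeasure (S.moranMeasure p'))
          (dimHMeasure (S.moranMeasure p)) ∧
        dimHMeasure (S.moranMeasure p) = dimH S.moranSet) ∧
      (IsGreatest (Set.range fun p' : S.Weights => dimPMeasure (S.moranMeasure p'))
          (dimPMeasure (S.moranMeasure p)) ∧
        dimPMeasure (S.moranMeasure p) = dimP S.moranSet) := by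
  obtain ⟨K, hK⟩ := hN
  have hKn : ∀ k, S.n k ≤ K := fun k => hK (Or.inl ⟨k, rfl⟩)
  have hH := MoranConstruction.dimHMeasure_uniformWeights hKn hnm hc
  have hP := MoranConstruction.dimPMeasure_uniformWeights hKn hnm hc
  refine ⟨S.uniformWeights, MoranConstruction.uniformWeights_apply, ⟨⟨⟨_, rfl⟩, ?_⟩, hH⟩,
    ⟨⟨_, rfl⟩, ?_⟩, hP⟩
  · rintro _ ⟨p, rfl⟩
    exact (MoranConstruction.dimHMeasure_le p).trans_eq hH.symm
  · rintro _ ⟨p, rfl⟩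
    exact (MoranConstruction.dimPMeasure_le p).trans_eq hP.symm
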